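/- Let $\mathbb{R}_{\max}=\mathbb{R}\cup\{-\infty\}$ be the max-plus semiring, with $x\oplus y=\max(x,y)$ and product $xy=x+y$ (with $-\infty$ absorbing). Let $\mathbb{G}=\mathbb{R}\cup\{-\infty,+\infty\}\cup\mathbb{R}^-$, where $\mathbb{R}^-=\{\underline{\alpha} : \alpha\in\mathbb{R}\}$ is a disjoint copy of $\mathbb{R}$. Set $|\underline{\alpha}|=\alpha$, and $|x|=x$ for $x\notin\mathbb{R}^-$. Order $\mathbb{G}$ totally by: $x\le_{\mathbb{G}} y$ iff $|x|<|y|$ when $x\notin\mathbb{R}^-$ and $y\in\mathbb{R}^-$, and iff $|x|\le|y|$ in all other cases. The sum $\oplus$ in $\mathbb{G}$ is the maximum for this order. The product is: $xy=-\infty$ if $x$ or $y$ is $-\infty$; otherwise $xy=+\infty$ if $x$ or $y$ is $+\infty$; otherwise $xy=|x|+|y|$ if $x,y\in\mathbb{R}$, and $xy=\underline{|x|+|y|}$ if $x$ or $y$ lies in $\mathbb{R}^-$. Let $n\in\mathbb{N}$. A mixed tropical affine inequality on $\mathbf{x}\in\mathbb{R}_{\max}^n$ is a constraint $$a_0\oplus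 a_1\mathbf{x}_1\oplus\cdots\oplus a_n\mathbf{x}_n\;\le_{\mathbb{G}}\; b_0\oplus b_1\mathbf{x}_1\oplus\cdots\oplus b_n\mathbf{x}_n,\qquad a_i\in\mathbb{R}_{\max},\ b_i\in\mathbb{G}.$$ A tropical polyhedron with mixed constraints is the set of all $\mathbf{x}\in\mathbb{R}_{\max}^n$ that satisfy a given finite system of mixed tropical affine inequalities. A set $C\subseteq\mathbb{R}_{\max}^n$ is tropically convex if $\lambda\mathbf{x}\oplus\mu\mathbf{y}\in C$ for all $\mathbf{x},\mathbf{y}\in C$ and all $\lambda,\mu\in\mathbb{R}_{\max}$ with $\lambda\oplus\mu=0$. A tropical hemispace is a tropically convex set $H\subseteq\mathbb{R}_{\max}^n$ whose complement $\mathbb{R}_{\max}^n\setminus H$ is also tropically convex. Then a subset $P\subseteq\mathbb{R}_{\max}^n$ is a tropical polyhedron with mixed constraints if and only if $P$ is the intersection of finitely many tropical hemispaces. -/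

import Mathlib

noncomputable section

namespace MixedTropical

/-- The max-plus semiring `ℝ ∪ {-∞}`: the tropical sum is `⊔` (with zero `⊥ = -∞`), the tropical
product is `+` (with unit `0`; `⊥` is absorbing). -/
abbrev MaxPlus : Type := WithBot ℝ

/-- The tropical segment `{ λ x ⊕ μ y ∣ λ ⊕ μ = 0 }` between two points of `MaxPlusⁿ`. -/
def tropicalSegment {n : ℕ} (x y : Fin n → MaxPlus) : Set (Fin n → MaxPlus) :=
  {z | ∃ s t : MaxPlus, s ⊔ t = 0 ∧ z = fun i => (s + x i) ⊔ (t + y i)}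

/-- Tropically convex subsets of `MaxPlusⁿ`. -/
def IsTropicallyConvex {n : ℕ} (C : Set (Fin n → MaxPlus)) : Prop :=
  ∀ x ∈ C, ∀ y ∈ C, tropicalSegment x y ⊆ C

/-- A tropical hemispace: a tropically convex set with tropically convex complement. -/
def IsHemispace {n : ℕ} (H : Set (Fin n → MaxPlus)) : Prop :=
  IsTropicallyConvex H ∧ IsTropicallyConvex Hᶜ

/-- The semiring `𝔾 = ℝ ∪ {-∞, +∞} ∪ ℝ⁻` of affine germs; `under α` is the element of the disjoint
copy `ℝ⁻` of `ℝ` that stands for the infinitesimal perturbation `α - ε` of `α`. -/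
inductive Germ : Type
  | negInf : Germ
  | real (α : ℝ) : Germ
  | under (α : ℝ) : Germ
  | posInf : Germ

namespace Germ

/-- The modulus of a germ. -/
def modulus : Germ → EReal
  | negInf => ⊥
  | real α => (α : EReal)
  | under α => (α : EReal)
  | posInf => ⊤

/-- The order on germs: `x ≤ y` means `|x| < |y|` when `x ∉ ℝ⁻` and `y ∈ ℝ⁻`, and `|x| ≤ |y|`
otherwise. -/
protected def le : Germ → Germ → Prop
  | under α, y => modulus (under α) ≤ modulus y
  | x, under β => modulus x < modulus (under β)
  | x, y => modulus x ≤ modulus y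

instance : LinearOrder Germ where
  le := Germ.le
  le_refl x := by cases x <;> simp [Germ.le]
  le_trans x y z hxy hyz := by
    cases x <;> cases y <;> cases z <;> simp_all [Germ.le, modulus] <;> linarith
  le_antisymm x y hxy hyx := by
    cases x <;> cases y <;> simp_all [Germ.le, modulus] <;> linarith
  le_total x y := by
    cases x <;> cases y <;> simp [Germ.le, modulus, le_total, lt_or_ge, le_or_gt]
  toDecidableLE := Classical.decRel _

instance : OrderBot Germ where
  bot := negInf
  bot_le x := show Germ.le negInf x by cases x <;> simp [Germ.le, modulus]

/-- The product of germs. (Their sum is the maximum `⊔`.) -/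
protected def mul : Germ → Germ → Germ
  | negInf, _ => negInf
  | _, negInf => negInf
  | posInf, _ => posInf
  | _, posInf => posInf
  | real α, real β => real (α + β)
  | real α, under β => under (α + β)
  | under α, real β => under (α + β)
  | under α, under β => under (α + β)

instance : Mul Germ := ⟨Germ.mul⟩

/-- The inclusion of `MaxPlus` into the germs. -/
def ofMaxPlus (x : MaxPlus) : Germ := WithBot.recBotCoe negInf real x

end Germ

/-- The value in `𝔾` of the tropical affine form `c₀ ⊕ c₁ x₁ ⊕ ⋯ ⊕ cₙ xₙ`. -/
def affineForm {n : ℕ} (c₀ : Germ) (c : Fin n → Germ) (x : Fin n → MaxPlus) : Germ :=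
  c₀ ⊔ Finset.univ.sup fun i => c i * Germ.ofMaxPlus (x i)

/-- A mixed tropical affine inequality
`a₀ ⊕ a₁ x₁ ⊕ ⋯ ⊕ aₙ xₙ ≤ b₀ ⊕ b₁ x₁ ⊕ ⋯ ⊕ bₙ xₙ`, given by its coefficients: those on the left
lie in `MaxPlus`, those on the right in `𝔾`. -/
structure MixedInequality (n : ℕ) where
  a₀ : MaxPlus
  a : Fin n → MaxPlus
  b₀ : Germ
  b : Fin n → Germ

/-- The set of solutions in `MaxPlusⁿ` of a mixed inequality. -/
def MixedInequality.solutions {n : ℕ} (I : MixedInequality n) : Set (Fin n → MaxPlus) :=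
  {x | affineForm (Germ.ofMaxPlus I.a₀) (fun i => Germ.ofMaxPlus (I.a i)) x ≤
    affineForm I.b₀ I.b x}

/-- A tropical polyhedron with mixed constraints: the set of vectors that satisfy finitely many
mixed inequalities. -/
def IsMixedPolyhedron {n : ℕ} (P : Set (Fin n → MaxPlus)) : Prop :=
  ∃ (r : ℕ) (I : Fin r → MixedInequality n), P = {x | ∀ k, x ∈ (I k).solutions}

end MixedTropical

end

/-!
Points `x` of `MaxPlusⁿ` are homogenized to vectors `(0, x)` indexed by `Option (Fin n)`, so that
affine forms become linear forms (`affineForm_eq_linearForm`) and tropically convex sets become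
sections of cones, that is, of sets closed under `⊔` and under real translations.

A mixed inequality is the conjunction of the inequalities that have a single term `aᵢ yᵢ` on the
left. Both such an inequality `aᵢ yᵢ ≤ b(y)` and its negation `b(y) < aᵢ yᵢ` are preserved by `⊔`
and by translations, so each of them defines a hemispace (`isTropicalCone_termLe`,
`isTropicalCone_compl_termLe`).

Conversely, the cones spanned by a hemispace and by its complement are disjoint. By Zorn's lemma
the first one extends to a cone `V` that avoids the second one and is maximal for this property,
and then the complement of `V` is a cone too (`exists_isTropicalCone_compl`). Such a `V` is
determined by its elements supported on at most two coordinates. The set of all `t` such that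
`V` contains both the unit vector `eᵢ` and `eᵢ ⊕ t eⱼ` is a lower set of reals, hence of the form
`{t | t ≤ αᵢⱼ}` for some germ `αᵢⱼ`. As both `V` and its complement are closed under `⊔`, a vector
`y` belongs to `V` if and only if `yⱼ ≤ ⨆ᵢ αᵢⱼ yᵢ` for all `j` (`exists_germ_mem_iff`). These are
finitely many mixed inequalities.
-/

noncomputable section

namespace MixedTropical

/-! ### Arithmetic of germs -/

namespace Germ

theorem le_def (x y : Germ) : x ≤ y ↔ Germ.le x y := Iff.rfl

theorem mul_def (x y : Germ) : x * y = Germ.mul x y := rfl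

@[simp] theorem ofMaxPlus_bot : ofMaxPlus ⊥ = negInf := rfl

@[simp] theorem ofMaxPlus_coe (t : ℝ) : ofMaxPlus (t : MaxPlus) = real t := rfl

@[simp] theorem mul_negInf (g : Germ) : g * negInf = negInf := by
  cases g <;> rfl

@[simp] theorem negInf_mul (g : Germ) : negInf * g = negInf := by
  cases g <;> rfl

theorem bot_lt_real (t : ℝ) : (⊥ : Germ) < real t :=
  lt_of_le_of_ne bot_le (by intro h; cases h)

theorem ofMaxPlus_mono : Monotone ofMaxPlus := by
  intro x y h
  induction x using WithBot.recBotCoe with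
  | bot => exact bot_le
  | coe x =>
    induction y using WithBot.recBotCoe with
    | bot => simp at h
    | coe y => simpa [le_def, Germ.le, modulus] using h

theorem mul_mono (g : Germ) : Monotone (g * ·) := by
  intro x y h
  cases g <;> cases x <;> cases y <;>
    simp_all [le_def, mul_def, Germ.mul, Germ.le, modulus, -EReal.coe_add, le_of_lt]

theorem real_mul_le_real_mul (t : ℝ) (x y : Germ) : real t * x ≤ real t * y ↔ x ≤ y := by
  cases x <;> cases y <;> simp [le_def, mul_def, Germ.mul, Germ.le, modulus, -EReal.coe_add]

theorem mul_real_mul (g x : Germ) (t : ℝ) : g * (real t * x) = real t * (g * x) := by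
  cases g <;> cases x <;> simp [mul_def, Germ.mul, add_left_comm]

theorem ofMaxPlus_add (t : ℝ) (x : MaxPlus) :
    ofMaxPlus ((t : MaxPlus) + x) = real t * ofMaxPlus x := by
  induction x using WithBot.recBotCoe with
  | bot => simp
  | coe x => rw [← WithBot.coe_add]; rfl

theorem mul_real_zero (g : Germ) : g * real 0 = g := by
  cases g <;> simp [mul_def, Germ.mul]

theorem mul_sup (g x y : Germ) : g * (x ⊔ y) = g * x ⊔ g * y := (mul_mono g).map_sup x y

theorem real_le_mul_real (g : Germ) (s t : ℝ) : real s ≤ g * real t ↔ real (s - t) ≤ g := by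
  cases g <;>
    simp [le_def, mul_def, Germ.mul, Germ.le, modulus, -EReal.coe_sub, -EReal.coe_add,
      sub_lt_iff_lt_add, add_comm]

/-- Germs are exactly the cuts of the real line. -/
theorem exists_real_le_iff_mem {D : Set ℝ} (hD : IsLowerSet D) :
    ∃ g : Germ, ∀ t : ℝ, real t ≤ g ↔ t ∈ D := by
  rcases D.eq_empty_or_nonempty with rfl | hne
  · exact ⟨negInf, fun t => by simp [le_def, Germ.le, modulus]⟩
  by_cases hb : BddAbove D
  · by_cases hs : sSup D ∈ D
    · refine ⟨real (sSup D), fun t => ?_⟩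
      simp only [le_def, Germ.le, modulus, EReal.coe_le_coe_iff]
      exact ⟨fun h => hD h hs, fun h => le_csSup hb h⟩
    · refine ⟨under (sSup D), fun t => ?_⟩
      simp only [le_def, Germ.le, modulus, EReal.coe_lt_coe_iff]
      refine ⟨fun h => ?_, fun h => lt_of_le_of_ne (le_csSup hb h) (by rintro rfl; exact hs h)⟩
      obtain ⟨d, hd, hlt⟩ := exists_lt_of_lt_csSup hne h
      exact hD hlt.le hd
  · refine ⟨posInf, fun t => ?_⟩
    simp only [le_def, Germ.le, modulus, le_top, true_iff]
    obtain ⟨d, hd, hlt⟩ := not_bddAbove_iff.1 hb t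
    exact hD hlt.le hd

end Germ

open MixedTropical.Germ

/-! ### Linear forms and homogenization -/

/-- The value in `𝔾` of the tropical linear form `⨁ᵢ cᵢ yᵢ`. -/
def linearForm {ι : Type*} [Fintype ι] (c : ι → Germ) (y : ι → MaxPlus) : Germ :=
  Finset.univ.sup fun i => c i * ofMaxPlus (y i)

theorem linearForm_sup {ι : Type*} [Fintype ι] (c : ι → Germ) (y z : ι → MaxPlus) :
    linearForm c (y ⊔ z) = linearForm c y ⊔ linearForm c z := by
  simp only [linearForm, Pi.sup_apply, ofMaxPlus_mono.map_sup, mul_sup]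
  exact Finset.sup_sup

theorem linearForm_add {ι : Type*} [Fintype ι] (c : ι → Germ) (t : ℝ) (y : ι → MaxPlus) :
    linearForm c (fun i => (t : MaxPlus) + y i) = real t * linearForm c y := by
  simp only [linearForm, ofMaxPlus_add, mul_real_mul]
  exact (Finset.apply_sup_eq_sup_comp (real t * ·) (mul_sup _) (mul_negInf _)).symm

theorem real_le_linearForm {ι : Type*} [Fintype ι] (c : ι → Germ) (y : ι → MaxPlus) (t : ℝ) :
    real t ≤ linearForm c y ↔ ∃ i, real t ≤ c i * ofMaxPlus (y i) := by
  simp [linearForm, Finset.le_sup_iff (bot_lt_real t)]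

/-- The vector `(0, x)` of homogeneous coordinates of `x`, the coordinate `none` being `0`. -/
def homogenize {n : ℕ} (x : Fin n → MaxPlus) : Option (Fin n) → MaxPlus
  | none => 0
  | some i => x i

theorem affineForm_eq_linearForm {n : ℕ} (c : Option (Fin n) → Germ) (x : Fin n → MaxPlus) :
    affineForm (c none) (fun i => c (some i)) x = linearForm c (homogenize x) := by
  have h0 : c none * ofMaxPlus 0 = c none := mul_real_zero _
  refine le_antisymm (sup_le ?_ (Finset.sup_le fun i _ => ?_)) (Finset.sup_le ?_)
  · rw [← h0]
    exact Finset.le_sup (f := fun i => c i * ofMaxPlus (homogenize x i)) (Finset.mem_univ none)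
  · exact Finset.le_sup (f := fun i => c i * ofMaxPlus (homogenize x i)) (Finset.mem_univ (some i))
  · rintro (_ | i) -
    · exact h0.le.trans le_sup_left
    · exact le_sup_of_le_right
        (Finset.le_sup (f := fun i => c (some i) * ofMaxPlus (x i)) (Finset.mem_univ i))

/-! ### Cones and hemispaces -/

/-- Tropical cones: sets of vectors closed under the tropical sum and under the multiplication by
the invertible scalars, which are the reals. The vector `⊥` may or may not belong to a cone, so
that the complement of a cone may be a cone. -/
structure IsTropicalCone {ι : Type*} (S : Set (ι → MaxPlus)) : Prop where
  sup_mem : ∀ {y z}, y ∈ S → z ∈ S → y ⊔ z ∈ S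
  add_mem : ∀ (t : ℝ) {y}, y ∈ S → (fun i => (t : MaxPlus) + y i) ∈ S

theorem add_neg_add {ι : Type*} (t : ℝ) (y : ι → MaxPlus) :
    (fun i => ((-t : ℝ) : MaxPlus) + ((t : MaxPlus) + y i)) = y := by
  funext i
  rw [← add_assoc, ← WithBot.coe_add]
  simp

theorem IsTropicalCone.add_mem_iff {ι : Type*} {S : Set (ι → MaxPlus)} (hS : IsTropicalCone S)
    (t : ℝ) (y : ι → MaxPlus) : (fun i => (t : MaxPlus) + y i) ∈ S ↔ y ∈ S := by
  refine ⟨fun h => ?_, hS.add_mem t⟩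
  simpa only [add_neg_add] using hS.add_mem (-t) h

/-- Sections of cones by the hyperplane where the homogenizing coordinate is `0` are convex. -/
theorem IsTropicalCone.isTropicallyConvex {n : ℕ} {S : Set (Option (Fin n) → MaxPlus)}
    (hS : IsTropicalCone S) : IsTropicallyConvex {x | homogenize x ∈ S} := by
  rintro x hx y hy z ⟨s, t, hst, rfl⟩
  induction s using WithBot.recBotCoe with
  | bot =>
    obtain rfl : t = 0 := by simpa using hst
    simpa using hy
  | coe s =>
    induction t using WithBot.recBotCoe with
    | bot =>
      have hs : (s : MaxPlus) = 0 := by simpa using hst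
      simpa [hs] using hx
    | coe t =>
      have key : homogenize (fun i => ((s : MaxPlus) + x i) ⊔ ((t : MaxPlus) + y i)) =
          (fun i => (s : MaxPlus) + homogenize x i) ⊔ (fun i => (t : MaxPlus) + homogenize y i) := by
        funext i
        cases i with
        | none => simpa [homogenize] using hst.symm
        | some i => rfl
      rw [Set.mem_ofPred_eq, key]
      exact hS.sup_mem (hS.add_mem s hx) (hS.add_mem t hy)

theorem isTropicalCone_termLe {ι : Type*} [Fintype ι] (a : Germ) (b : ι → Germ) (i : ι) :
    IsTropicalCone {y : ι → MaxPlus | a * ofMaxPlus (y i) ≤ linearForm b y} where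
  sup_mem {y z} hy hz := by
    simp only [Set.mem_ofPred_eq, linearForm_sup, Pi.sup_apply, ofMaxPlus_mono.map_sup,
      mul_sup] at *
    exact sup_le_sup hy hz
  add_mem t y hy := by
    simpa only [Set.mem_ofPred_eq, linearForm_add, ofMaxPlus_add, mul_real_mul,
      real_mul_le_real_mul] using hy

theorem isTropicalCone_compl_termLe {ι : Type*} [Fintype ι] (a : Germ) (b : ι → Germ) (i : ι) :
    IsTropicalCone {y : ι → MaxPlus | a * ofMaxPlus (y i) ≤ linearForm b y}ᶜ where
  sup_mem {y z} hy hz := by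
    simp only [Set.mem_compl_iff, Set.mem_ofPred_eq, linearForm_sup, Pi.sup_apply,
      ofMaxPlus_mono.map_sup, mul_sup, not_le] at *
    exact max_lt_max hy hz
  add_mem t y hy := by
    simpa only [Set.mem_compl_iff, Set.mem_ofPred_eq, linearForm_add, ofMaxPlus_add, mul_real_mul,
      real_mul_le_real_mul] using hy

theorem isHemispace_termLe {n : ℕ} (a : Germ) (b : Option (Fin n) → Germ) (i : Option (Fin n)) :
    IsHemispace {x : Fin n → MaxPlus |
      a * ofMaxPlus (homogenize x i) ≤ linearForm b (homogenize x)} :=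
  ⟨(isTropicalCone_termLe a b i).isTropicallyConvex,
    (isTropicalCone_compl_termLe a b i).isTropicallyConvex⟩

/-- A mixed inequality is the conjunction of its `n + 1` parts with a single term on the left. -/
theorem MixedInequality.mem_solutions_iff {n : ℕ} (I : MixedInequality n) (x : Fin n → MaxPlus) :
    x ∈ I.solutions ↔ ∀ i : Option (Fin n),
      (i.elim (ofMaxPlus I.a₀) fun i => ofMaxPlus (I.a i)) * ofMaxPlus (homogenize x i) ≤
        linearForm (fun i : Option (Fin n) => i.elim I.b₀ I.b) (homogenize x) := by
  have ha := affineForm_eq_linearForm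
    (fun i : Option (Fin n) => i.elim (ofMaxPlus I.a₀) fun i => ofMaxPlus (I.a i)) x
  have hb := affineForm_eq_linearForm (fun i : Option (Fin n) => i.elim I.b₀ I.b) x
  simp only [Option.elim_none, Option.elim_some] at ha hb
  rw [MixedInequality.solutions, Set.mem_ofPred_eq, ha, hb]
  simp [linearForm]

/-! ### Separation of cones -/

/-- Separation of disjoint cones by a cone whose complement is a cone. -/
theorem exists_isTropicalCone_compl {ι : Type*} {A B : Set (ι → MaxPlus)} (hA : IsTropicalCone A)
    (hB : IsTropicalCone B) (hAB : Disjoint A B) (hbot : ⊥ ∈ A) :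
    ∃ V : Set (ι → MaxPlus), IsTropicalCone V ∧ IsTropicalCone Vᶜ ∧ A ⊆ V ∧ Disjoint V B := by
  obtain ⟨V, hAV, hV⟩ := zorn_subset_nonempty
    {S : Set (ι → MaxPlus) | IsTropicalCone S ∧ Disjoint S B}
    (by
      intro c hc hchain hne
      refine ⟨⋃₀ c, ⟨⟨?_, ?_⟩, ?_⟩, fun S hS => Set.subset_sUnion_of_mem hS⟩
      · rintro y z ⟨S, hS, hy⟩ ⟨T, hT, hz⟩
        rcases hchain.total hS hT with h | h
        · exact ⟨T, hT, (hc hT).1.sup_mem (h hy) hz⟩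
        · exact ⟨S, hS, (hc hS).1.sup_mem hy (h hz)⟩
      · rintro t y ⟨S, hS, hy⟩
        exact ⟨S, hS, (hc hS).1.add_mem t hy⟩
      · exact Set.disjoint_sUnion_left.2 fun S hS => (hc hS).2)
    A ⟨hA, hAB⟩
  obtain ⟨hcone, hdisj⟩ := hV.prop
  -- If `p ∉ V`, the cone generated by `V` and `p` meets `B`, by maximality of `V`.
  have hmeet : ∀ p ∉ V, ∃ v ∈ V, v ⊔ p ∈ B := by
    intro p hp
    by_contra! hcon
    have hW : V ∪ {y | ∃ v ∈ V, ∃ t : ℝ, y = v ⊔ fun i => (t : MaxPlus) + p i} ⊆ V := by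
      refine hV.le_of_ge ⟨⟨?_, ?_⟩, ?_⟩ Set.subset_union_left
      · rintro y z (hy | ⟨v, hv, t, rfl⟩) (hz | ⟨w, hw, s, rfl⟩)
        · exact Or.inl (hcone.sup_mem hy hz)
        · exact Or.inr ⟨y ⊔ w, hcone.sup_mem hy hw, s, (sup_assoc _ _ _).symm⟩
        · exact Or.inr ⟨v ⊔ z, hcone.sup_mem hv hz, t, sup_right_comm _ _ _⟩
        · refine Or.inr ⟨v ⊔ w, hcone.sup_mem hv hw, t ⊔ s, ?_⟩
          rw [sup_sup_sup_comm]
          congr 1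
          funext i
          simp only [Pi.sup_apply, WithBot.coe_max]
          exact (max_add_add_right _ _ _)
      · rintro t y (hy | ⟨v, hv, s, rfl⟩)
        · exact Or.inl (hcone.add_mem t hy)
        · refine Or.inr ⟨_, hcone.add_mem t hv, t + s, ?_⟩
          funext i
          simp only [Pi.sup_apply, WithBot.coe_add, add_assoc]
          exact (max_add_add_left _ _ _).symm
      · refine Set.disjoint_left.2 ?_
        rintro y (hy | ⟨v, hv, t, rfl⟩) hyB
        · exact Set.disjoint_left.1 hdisj hy hyB
        · refine hcon _ (hcone.add_mem (-t) hv) ?_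
          convert hB.add_mem (-t) hyB using 1
          funext i
          have h := congrFun (add_neg_add t p) i
          simp only [Pi.sup_apply]
          rw [← max_add_add_left, h]
    refine hp (hW (Or.inr ⟨⊥, hAV hbot, 0, ?_⟩))
    funext i
    simp
  refine ⟨V, hcone, ⟨?_, fun t y hy h => hy ((hcone.add_mem_iff t y).1 h)⟩, hAV, hdisj⟩
  intro p q hp hq hpq
  obtain ⟨v, hv, hvp⟩ := hmeet p hp
  obtain ⟨w, hw, hwq⟩ := hmeet q hq
  have h := hB.sup_mem hvp hwq
  rw [sup_sup_sup_comm] at h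
  exact Set.disjoint_left.1 hdisj (hcone.sup_mem (hcone.sup_mem hv hw) hpq) h

/-! ### Cones with a conical complement -/

/-- The vector `t eᵢ`, with `t` in the coordinate `i` and `-∞` in the others. -/
def singleVec {ι : Type*} [DecidableEq ι] (i : ι) (t : MaxPlus) : ι → MaxPlus :=
  Function.update ⊥ i t

theorem singleVec_bot {ι : Type*} [DecidableEq ι] (i : ι) : singleVec i ⊥ = ⊥ :=
  Function.update_eq_self i _

theorem singleVec_le_iff {ι : Type*} [DecidableEq ι] {i : ι} {t : MaxPlus} {y : ι → MaxPlus} :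
    singleVec i t ≤ y ↔ t ≤ y i := by
  simp [singleVec, update_le_iff]

theorem singleVec_add {ι : Type*} [DecidableEq ι] (i : ι) (t : ℝ) (s : MaxPlus) :
    (fun k => (t : MaxPlus) + singleVec i s k) = singleVec i (t + s) := by
  funext k
  by_cases h : k = i
  · subst h; simp [singleVec]
  · simp [singleVec, h]

theorem add_sup_singleVec {ι : Type*} [DecidableEq ι] (i j : ι) (t : ℝ) (r s : MaxPlus) :
    (fun k => (t : MaxPlus) + (singleVec i r ⊔ singleVec j s) k) =
      singleVec i (t + r) ⊔ singleVec j (t + s) := by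
  rw [← singleVec_add, ← singleVec_add]
  funext k
  exact (max_add_add_left _ _ _).symm

/-- The germs of the inequalities that define `V`: the reals below `αᵢⱼ` are the `t` such that
`eᵢ` and `eᵢ ⊕ t eⱼ` belong to `V`. -/
theorem IsTropicalCone.exists_germ {ι : Type*} [DecidableEq ι] {V : Set (ι → MaxPlus)}
    (hV : IsTropicalCone V) (i j : ι) :
    ∃ g : Germ, ∀ s t : ℝ, real s ≤ g * real t ↔
      singleVec i t ∈ V ∧ singleVec i t ⊔ singleVec j s ∈ V := by
  obtain ⟨g, hg⟩ := exists_real_le_iff_mem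
    (D := {t : ℝ | singleVec i 0 ∈ V ∧ singleVec i 0 ⊔ singleVec j (t : MaxPlus) ∈ V}) (by
      rintro t s hst ⟨hi, ht⟩
      refine ⟨hi, ?_⟩
      -- `eᵢ ⊕ s eⱼ` is the sum of `eᵢ` and of the multiple of `eᵢ ⊕ t eⱼ` by `s - t ≤ 0`.
      have h := hV.sup_mem hi (hV.add_mem (s - t) ht)
      have hle : singleVec i ((s - t : ℝ) : MaxPlus) ≤ singleVec i 0 := by
        rw [singleVec_le_iff]
        simpa [singleVec, ← WithBot.coe_zero] using hst
      rwa [add_sup_singleVec, ← sup_assoc, ← WithBot.coe_add, sub_add_cancel, add_zero,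
        sup_eq_left.2 hle] at h)
  refine ⟨g, fun s t => ?_⟩
  rw [real_le_mul_real, hg, Set.mem_ofPred_eq, ← hV.add_mem_iff t (singleVec i 0),
    ← hV.add_mem_iff t (singleVec i 0 ⊔ _), singleVec_add, add_sup_singleVec, ← WithBot.coe_add]
  simp

theorem exists_germ_mem_iff {ι : Type*} [Fintype ι] {V : Set (ι → MaxPlus)}
    (hV : IsTropicalCone V) (hV' : IsTropicalCone Vᶜ) (hbot : ⊥ ∈ V) :
    ∃ α : ι → ι → Germ, ∀ y : ι → MaxPlus,
      y ∈ V ↔ ∀ j, ofMaxPlus (y j) ≤ linearForm (fun i => α i j) y := by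
  classical
  choose α hα using fun i j => hV.exists_germ i j
  have hsup : ∀ f : ι → ι → MaxPlus, (∀ i, f i ∈ V) → Finset.univ.sup f ∈ V := fun f hf =>
    Finset.sup_induction hbot (fun _ ha _ hb => hV.sup_mem ha hb) fun i _ => hf i
  refine ⟨α, fun y => ⟨fun hy j => ?_, fun h => ?_⟩⟩
  · cases hj : y j using WithBot.recBotCoe with
    | bot => exact bot_le
    | coe s =>
      rw [ofMaxPlus_coe, real_le_linearForm]
      by_contra! hcon
      have hne : ∀ i, ∀ t : ℝ, y i = t →
          ¬ (singleVec i (t : MaxPlus) ∈ V ∧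
            singleVec i (t : MaxPlus) ⊔ singleVec j (s : MaxPlus) ∈ V) := by
        intro i t hi
        rw [← hα, not_le]
        simpa [hi] using hcon i
      have hjV : singleVec j (s : MaxPlus) ∈ Vᶜ := fun h => hne j s hj ⟨h, by simpa using h⟩
      have hiV : ∀ i, singleVec i (y i) ⊔ singleVec j (s : MaxPlus) ∈ Vᶜ := by
        intro i
        cases hi : y i using WithBot.recBotCoe with
        | bot => simpa [singleVec_bot] using hjV
        | coe t =>
          by_cases h : singleVec i (t : MaxPlus) ∈ V
          · exact fun h' => hne i t hi ⟨h, h'⟩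
          · exact hV'.sup_mem h hjV
      -- Every two-coordinate part `yᵢ eᵢ ⊕ yⱼ eⱼ` of `y` lies outside `V`, hence so does `y`.
      have hyV : Finset.univ.sup' ⟨j, Finset.mem_univ j⟩
          (fun i => singleVec i (y i) ⊔ singleVec j (s : MaxPlus)) ∈ Vᶜ :=
        Finset.sup'_induction _ _ (fun _ ha _ hb => hV'.sup_mem ha hb) fun i _ => hiV i
      refine hyV ?_
      convert hy
      refine le_antisymm (Finset.sup'_le _ _ fun i _ => ?_) fun i => ?_
      · exact sup_le (singleVec_le_iff.2 le_rfl) (singleVec_le_iff.2 hj.ge)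
      · exact singleVec_le_iff.1 (le_sup_left.trans (Finset.le_sup'
          (fun i => singleVec i (y i) ⊔ singleVec j (s : MaxPlus)) (Finset.mem_univ i)))
  · have hex : ∀ j, ∃ v ∈ V, v ≤ y ∧ y j ≤ v j := by
      intro j
      cases hj : y j using WithBot.recBotCoe with
      | bot => exact ⟨⊥, hbot, bot_le, bot_le⟩
      | coe s =>
        have hj' := h j
        rw [hj, ofMaxPlus_coe, real_le_linearForm] at hj'
        obtain ⟨i, hi⟩ := hj'
        cases ht : y i using WithBot.recBotCoe with
        | bot =>
          rw [ht, ofMaxPlus_bot, mul_negInf] at hi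
          exact absurd hi (bot_lt_real s).not_ge
        | coe t =>
          rw [ht, ofMaxPlus_coe, hα] at hi
          exact ⟨_, hi.2, sup_le (singleVec_le_iff.2 ht.ge) (singleVec_le_iff.2 hj.ge),
            singleVec_le_iff.1 le_sup_right⟩
    choose v hv hvy hyv using hex
    convert hsup v hv
    refine le_antisymm (fun j => ?_) (Finset.sup_le fun j _ => hvy j)
    exact (hyv j).trans (Finset.le_sup (f := v) (Finset.mem_univ j) j)

/-! ### Hemispaces are mixed polyhedra -/

/-- The cone spanned by the homogenization of a subset of `MaxPlusⁿ`, without the vector `⊥`. -/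
def homogenizedCone {n : ℕ} (C : Set (Fin n → MaxPlus)) : Set (Option (Fin n) → MaxPlus) :=
  {y | ∃ x ∈ C, ∃ t : ℝ, y = fun i => (t : MaxPlus) + homogenize x i}

theorem homogenize_mem_homogenizedCone {n : ℕ} {C : Set (Fin n → MaxPlus)} {x : Fin n → MaxPlus}
    (hx : x ∈ C) : homogenize x ∈ homogenizedCone C :=
  ⟨x, hx, 0, by simp⟩

theorem bot_notMem_homogenizedCone {n : ℕ} (C : Set (Fin n → MaxPlus)) :
    ⊥ ∉ homogenizedCone C := by
  rintro ⟨x, -, t, h⟩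
  simpa [homogenize] using congrFun h none

theorem IsTropicallyConvex.isTropicalCone_homogenizedCone {n : ℕ} {C : Set (Fin n → MaxPlus)}
    (hC : IsTropicallyConvex C) : IsTropicalCone (homogenizedCone C) where
  sup_mem := by
    rintro _ _ ⟨x, hx, s, rfl⟩ ⟨y, hy, t, rfl⟩
    -- Dividing the coefficients `s` and `t` by `s ⊕ t` makes their sum equal to the unit `0`.
    refine ⟨_, hC x hx y hy ⟨((s - s ⊔ t : ℝ) : MaxPlus), ((t - s ⊔ t : ℝ) : MaxPlus), ?_, rfl⟩,
      s ⊔ t, ?_⟩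
    · rw [← WithBot.coe_max, max_sub_sub_right, sub_self, WithBot.coe_zero]
    · funext i
      cases i with
      | none => simp [homogenize]
      | some i =>
        simp only [homogenize, Pi.sup_apply]
        rw [← max_add_add_left, ← add_assoc, ← add_assoc, ← WithBot.coe_add, ← WithBot.coe_add,
          add_sub_cancel, add_sub_cancel]
  add_mem := by
    rintro t _ ⟨x, hx, s, rfl⟩
    exact ⟨x, hx, t + s, by simp only [WithBot.coe_add, add_assoc]⟩

theorem disjoint_homogenizedCone_compl {n : ℕ} (C : Set (Fin n → MaxPlus)) :
    Disjoint (homogenizedCone C) (homogenizedCone Cᶜ) := by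
  refine Set.disjoint_left.2 ?_
  rintro _ ⟨x, hx, s, rfl⟩ ⟨y, hy, t, h⟩
  obtain rfl : s = t := by simpa [homogenize] using congrFun h none
  refine hy ?_
  convert hx using 1
  funext i
  have hi := congrFun (add_neg_add s (homogenize x)) (some i)
  have hi' := congrFun (add_neg_add s (homogenize y)) (some i)
  have h' := congrFun h (some i)
  simp only [homogenize] at hi hi' h'
  rw [h', hi'] at hi
  exact hi

/-- A hemispace is defined by `n + 1` linear inequalities in homogeneous coordinates. -/
theorem IsHemispace.exists_germ_mem_iff {n : ℕ} {H : Set (Fin n → MaxPlus)} (hH : IsHemispace H) :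
    ∃ α : Option (Fin n) → Option (Fin n) → Germ, ∀ x, x ∈ H ↔
      ∀ j, ofMaxPlus (homogenize x j) ≤ linearForm (fun i => α i j) (homogenize x) := by
  have hB := hH.2.isTropicalCone_homogenizedCone
  have hA : IsTropicalCone (insert ⊥ (homogenizedCone H)) := by
    have hA' := hH.1.isTropicalCone_homogenizedCone
    refine ⟨?_, ?_⟩
    · rintro y z (rfl | hy) (rfl | hz)
      · simp
      · simpa using Or.inr hz
      · simpa using Or.inr hy
      · exact Or.inr (hA'.sup_mem hy hz)
    · rintro t y (rfl | hy)
      · exact Or.inl (funext fun i => by simp)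
      · exact Or.inr (hA'.add_mem t hy)
  obtain ⟨V, hV, hV', hAV, hVB⟩ := exists_isTropicalCone_compl hA hB
    (Set.disjoint_insert_left.2
      ⟨bot_notMem_homogenizedCone _, disjoint_homogenizedCone_compl H⟩) (Set.mem_insert _ _)
  obtain ⟨α, hα⟩ := MixedTropical.exists_germ_mem_iff hV hV' (hAV (Set.mem_insert _ _))
  refine ⟨α, fun x => ?_⟩
  rw [← hα]
  refine ⟨fun hx => hAV (Or.inr (homogenize_mem_homogenizedCone hx)), fun hx => ?_⟩
  by_contra hxH
  exact Set.disjoint_left.1 hVB hx (homogenize_mem_homogenizedCone hxH)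

theorem exists_solutions_iff {n : ℕ} (j : Option (Fin n)) (b : Option (Fin n) → Germ) :
    ∃ I : MixedInequality n, ∀ x, x ∈ I.solutions ↔
      ofMaxPlus (homogenize x j) ≤ linearForm b (homogenize x) := by
  classical
  refine ⟨⟨singleVec j 0 none, fun i => singleVec j 0 (some i), b none, fun i => b (some i)⟩,
    fun x => ?_⟩
  have ha := affineForm_eq_linearForm (fun i => ofMaxPlus (singleVec j 0 i)) x
  have hb := affineForm_eq_linearForm b x
  rw [MixedInequality.solutions, Set.mem_ofPred_eq, ha, hb]
  suffices h : linearForm (fun i => ofMaxPlus (singleVec j 0 i)) (homogenize x) =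
      ofMaxPlus (homogenize x j) by rw [h]
  have hone : ofMaxPlus 0 * ofMaxPlus (homogenize x j) = ofMaxPlus (homogenize x j) := by
    rw [show ofMaxPlus 0 = real 0 from rfl, ← ofMaxPlus_add, WithBot.coe_zero, zero_add]
  refine le_antisymm (Finset.sup_le fun i _ => ?_) ?_
  · by_cases h : i = j
    · subst h
      simp [singleVec, hone]
    · simp only [singleVec, Function.update_of_ne h, Pi.bot_apply, ofMaxPlus_bot, negInf_mul]
      exact bot_le
  · have h := Finset.le_sup (f := fun i => ofMaxPlus (singleVec j 0 i) * ofMaxPlus (homogenize x i))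
      (Finset.mem_univ j)
    rwa [singleVec, Function.update_self, hone] at h

end MixedTropical

end

open MixedTropical in
theorem mainTheorem4 (n : ℕ) (P : Set (Fin n → MixedTropical.MaxPlus)) :
    MixedTropical.IsMixedPolyhedron P ↔
      ∃ (m : ℕ) (H : Fin m → Set (Fin n → MixedTropical.MaxPlus)),
        (∀ k, MixedTropical.IsHemispace (H k)) ∧ P = ⋂ k, H k := by
  constructor
  · rintro ⟨r, I, rfl⟩
    let e := (Fintype.equivFin (Fin r × Option (Fin n))).symm
    refine ⟨_, fun k => {x | _}, fun k => isHemispace_termLe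
      ((e k).2.elim (Germ.ofMaxPlus (I (e k).1).a₀) fun i => Germ.ofMaxPlus ((I (e k).1).a i))
      (fun i => i.elim (I (e k).1).b₀ (I (e k).1).b) (e k).2, ?_⟩
    ext x
    simp only [Set.mem_ofPred_eq, Set.mem_iInter, MixedInequality.mem_solutions_iff]
    exact ⟨fun h k => h (e k).1 (e k).2, fun h k i => by simpa using h (e.symm (k, i))⟩
  · rintro ⟨m, H, hH, rfl⟩
    choose α hα using fun k => (hH k).exists_germ_mem_iff
    choose I hI using fun (k : Fin m) (j : Option (Fin n)) =>
      exists_solutions_iff j fun i => α k i j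
    let e := (Fintype.equivFin (Fin m × Option (Fin n))).symm
    refine ⟨_, fun k => I (e k).1 (e k).2, ?_⟩
    ext x
    simp only [Set.mem_ofPred_eq, Set.mem_iInter, hα, hI]
    exact ⟨fun h k => h (e k).1 (e k).2, fun h k i => by simpa using h (e.symm (k, i))⟩
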